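/- Let $\mathbf{B}=(b_{i,j})$ be an $n_c\times n_v$ matrix of non-negative integers, regarded as a protograph: a bipartite multigraph with check nodes $c_1,\dots,c_{n_c}$, variable nodes $v_1,\dots,v_{n_v}$ and $b_{i,j}$ parallel edges between $c_i$ and $v_j$. Let a set of $x\ge 0$ of the variable nodes be chosen to be partially doped, and let $\mathcal C$ be a $(\mu,\kappa)$ binary Hamming code, i.e. $\mu=2^r-1$, $\kappa=\mu-r$ with $r\ge 2$, and $\mathcal C$ has a parity-check matrix whose columns are the nonzero vectors of $\{0,1\}^r$, each exactly once. For $N=\mu\beta$, a code of the $(\mathbf{B},\mu,\kappa,N,x)$ protograph-based PD-GLDPC ensemble has block length $n=n_vN$ and is obtained as follows. Take $N$ copies of the protograph and, for each edge $e$ between $c_i$ and $v_j$, permute the $N$ copies of $e$ among the copies of $c_i$ and $v_j$ by a permutation $\pi_e$, the $\pi_e$ being independent and uniformly random. A binary word, with one symbol on each copy of each variable node, is a codeword if the symbols at each copy of each check node (counted with multiplicity) sum to $0$ modulo $2$, and if, for each doped variable node, each of the $\beta$ consecutive blocks of $\mu$ of its $N$ copies carries a codeword of $\mathcal C$. Suppose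 that every undoped variable node has degree at least $2$, that every doped variable node has degree at least $1$, and that the undoped variable nodes of degree $2$ form no cycle among themselves in the protograph, that is, the sub-multigraph consisting of the undoped variable nodes of degree $2$, their edges and the check nodes contains no cycle (a pair of parallel edges counts as a cycle). Then the ensemble has a typical minimum distance that grows linearly with the block length: there is a constant $\delta>0$, depending only on $\mathbf{B}$, the set of doped nodes and $\mathcal C$, such that $$\Pr\bigl[d_{\min}<\delta\, n_v N\bigr]\longrightarrow 0\qquad\text{as } N=\mu\beta\to\infty,$$ where $d_{\min}$ is the least Hamming weight of a nonzero codeword ($d_{\min}=\infty$ for the zero code). -/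

import Mathlib

open Filter Topology
open scoped ENNReal

namespace PDGLDPC

/-- The degree of the variable node `j` of the protograph with base matrix `B` (rows are check
nodes, columns are variable nodes, entries are numbers of parallel edges). -/
def varDegree {nc nv : ℕ} (B : Matrix (Fin nc) (Fin nv) ℕ) (j : Fin nv) : ℕ :=
  ∑ i, B i j

/-- The edges of the protograph: `⟨i, j, k⟩` is the `k`-th of the `B i j` parallel edges between
the check node `i` and the variable node `j`. -/
abbrev Edge {nc nv : ℕ} (B : Matrix (Fin nc) (Fin nv) ℕ) : Type :=
  Σ i : Fin nc, Σ j : Fin nv, Fin (B i j)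

/-- The variable node `j` is not doped (`D` is the set of the partially doped variable nodes) and
has degree two. -/
def IsUndopedDegTwo {nc nv : ℕ} (B : Matrix (Fin nc) (Fin nv) ℕ) (D : Finset (Fin nv))
    (j : Fin nv) : Prop :=
  j ∉ D ∧ varDegree B j = 2

/-- The simple bipartite graph on variable and check nodes that keeps only the adjacencies of the
undoped variable nodes of degree two. -/
def undopedDegTwoGraph {nc nv : ℕ} (B : Matrix (Fin nc) (Fin nv) ℕ) (D : Finset (Fin nv)) :
    SimpleGraph (Fin nv ⊕ Fin nc) :=
  SimpleGraph.fromRel fun a b =>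
    ∃ j i, a = Sum.inl j ∧ b = Sum.inr i ∧ IsUndopedDegTwo B D j ∧ B i j ≠ 0

/-- The undoped variable nodes of degree two form no cycle among themselves in the protograph.
The protograph is a multigraph: a cycle is either a pair of parallel edges, or a cycle of the
underlying simple graph. -/
def NoUndopedDegTwoCycle {nc nv : ℕ} (B : Matrix (Fin nc) (Fin nv) ℕ) (D : Finset (Fin nv)) :
    Prop :=
  (∀ i j, IsUndopedDegTwo B D j → B i j ≤ 1) ∧ (undopedDegTwoGraph B D).IsAcyclic

/-- The columns of `H` are the nonzero binary vectors of length `r`, each exactly once. -/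
def IsHammingCheckMatrix {r μ : ℕ} (H : Matrix (Fin r) (Fin μ) (ZMod 2)) : Prop :=
  Function.Injective H.col ∧ Set.range H.col = {v | v ≠ 0}

/-- `C` is a `(μ, κ)` Hamming code (so `μ = 2 ^ r - 1` and `κ = μ - r` with `r ≥ 2`). -/
def IsHammingCode {μ : ℕ} (κ : ℕ) (C : Submodule (ZMod 2) (Fin μ → ZMod 2)) : Prop :=
  ∃ r : ℕ, 2 ≤ r ∧ κ + r = μ ∧ ∃ H : Matrix (Fin r) (Fin μ) (ZMod 2),
    IsHammingCheckMatrix H ∧ ∀ w, w ∈ C ↔ H.mulVec w = 0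

/-- The `N = β * μ` copies of a protograph node or edge, arranged in `β` blocks of length `μ`. -/
abbrev Copy (μ β : ℕ) : Type := Fin β × Fin μ

/-- A lifting of the protograph by `N = β * μ`: one permutation of the copies for every edge. The
copy of the edge `e` that starts at the variable copy `s` ends at the check copy `π e s`. -/
abbrev Lifting {nc nv : ℕ} (B : Matrix (Fin nc) (Fin nv) ℕ) (μ β : ℕ) : Type :=
  Edge B → Equiv.Perm (Copy μ β)

/-- The PD-GLDPC code of a lifting. Every copy of every check node is a single parity check on the
symbols at the ends of its edge copies, and, for every doped variable node, each of the `β` blocks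
of its `N` copies is a codeword of the component code `C`. -/
def code {nc nv : ℕ} {B : Matrix (Fin nc) (Fin nv) ℕ} (D : Finset (Fin nv)) {μ β : ℕ}
    (C : Submodule (ZMod 2) (Fin μ → ZMod 2)) (π : Lifting B μ β) :
    Submodule (ZMod 2) (Fin nv × Copy μ β → ZMod 2) where
  carrier := {c |
    (∀ (i : Fin nc) (s : Copy μ β),
      ∑ j : Fin nv, ∑ k : Fin (B i j), c (j, (π ⟨i, j, k⟩).symm s) = 0) ∧
    ∀ j ∈ D, ∀ b : Fin β, (fun t : Fin μ => c (j, (b, t))) ∈ C}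
  add_mem' := by
    rintro a c ⟨ha, ha'⟩ ⟨hc, hc'⟩
    refine ⟨fun i s => ?_, fun j hj b => C.add_mem (ha' j hj b) (hc' j hj b)⟩
    simp only [Pi.add_apply, Finset.sum_add_distrib, ha i s, hc i s, add_zero]
  zero_mem' := ⟨fun i s => by simp, fun j hj b => C.zero_mem⟩
  smul_mem' := by
    rintro a c ⟨hc, hc'⟩
    refine ⟨fun i s => ?_, fun j hj b => C.smul_mem a (hc' j hj b)⟩
    simp only [Pi.smul_apply, ← Finset.smul_sum, hc i s, smul_zero]

/-- The minimum distance of a binary linear code: the least Hamming weight of a nonzero codeword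
(`⊤` for the zero code). -/
noncomputable def minDist {ι : Type*} [Fintype ι] (C : Submodule (ZMod 2) (ι → ZMod 2)) : ℕ∞ :=
  ⨅ c ∈ C, ⨅ _ : c ≠ 0, (hammingNorm c : ℕ∞)

/-- The probability of the event `P` for a uniformly random lifting, that is, for independent
uniformly random permutations on the edges of the protograph. -/
noncomputable def liftingProb {nc nv : ℕ} (B : Matrix (Fin nc) (Fin nv) ℕ) (μ β : ℕ)
    (P : Lifting B μ β → Prop) : ℝ :=
  (Nat.card {π : Lifting B μ β // P π} : ℝ) / Nat.card (Lifting B μ β)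

/-- The PD-GLDPC ensemble has a typical minimum distance: for some `δ > 0`, the probability that
the minimum distance is smaller than `δ` times the block length `nv * N` tends to zero as
`N = β * μ` tends to infinity. -/
def HasTypicalMinDist {nc nv : ℕ} (B : Matrix (Fin nc) (Fin nv) ℕ) (D : Finset (Fin nv)) {μ : ℕ}
    (C : Submodule (ZMod 2) (Fin μ → ZMod 2)) : Prop :=
  ∃ δ : ℝ, 0 < δ ∧
    Tendsto (fun β : ℕ => liftingProb B μ β fun π =>
      (minDist (code D C π) : ℝ≥0∞) < ENNReal.ofReal (δ * (nv * (β * μ)))) atTop (𝓝 0)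

end PDGLDPC

/-!
A first moment argument over words. Let `N = β * μ`, let `c` be a word of weight `w = t * N`, and
let `d j` be its weight on the copies of the variable node `j`, of degree `q j`. A uniformly random
permutation carries the symbols of `c` along one edge to prescribed places with probability at most
`t ^ d j`, so prescribed inputs of all checks have probability at most `t ^ ∑ q j * d j`. If `c` is
a codeword, every check copy with a nonzero input receives at least two ones, hence there are at
most `∑ q j * d j / 2` of them, and a sum over such sparse inputs shows that `c` is a codeword with
probability at most `exp (O(w)) * t ^ (∑ q j * d j / 2)`.

Summing `t ^ #(nonzero blocks of c)` over all words costs only another factor `exp (O(w))`, so what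
is needed is a gap `#(nonzero blocks of c) + a * w ≤ ∑ q j * d j / 2` with `a > 0`. A node for which
every nonzero block meets at least three edges contributes to the gap proportionally to `d j`; the
undoped nodes of degree two contribute nothing. But at each check an edge carries at most half of
the total weight, and if the nodes of degree two form no cycle then no nonzero `d` supported on them
satisfies these inequalities (look at a leaf). By compactness the other nodes carry a fixed fraction
of `w`, which is the gap. The expected number of codewords of weight `w` is therefore at most
`(K * (w / N) ^ a) ^ w`, and the sum over `0 < w < x * N` tends to zero as soon as `K * x ^ a < 1`.
-/

namespace PDGLDPC

open Finset

section Counting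

theorem card_perm_comp_symm_eq_le {α M : Type*} [Finite α] (f h : α → M) :
    Nat.card {σ : Equiv.Perm α // f ∘ σ.symm = h} ≤ Nat.card {σ : Equiv.Perm α // f ∘ σ = f} := by
  obtain _ | ⟨⟨τ, hτ⟩⟩ := isEmpty_or_nonempty {σ : Equiv.Perm α // f ∘ σ.symm = h}
  · simp
  refine Nat.card_le_card_of_injective (fun σ => ⟨τ.trans σ.1.symm, ?_⟩) fun σ σ' hσ => ?_
  · funext a
    simpa using congrFun (σ.2.trans hτ.symm) (τ a)
  · ext a
    simpa [Equiv.symm_apply_eq] using congrArg (fun ρ => ρ.1.symm a) hσ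

theorem card_perm_comp_eq_self {α : Type*} [Fintype α] (f : α → ZMod 2) :
    Nat.card {σ : Equiv.Perm α // f ∘ σ = f}
      = (hammingNorm f).factorial * (Fintype.card α - hammingNorm f).factorial := by
  classical
  have hzero : Fintype.card {a // f a = 0} = Fintype.card α - hammingNorm f := by
    rw [Fintype.card_subtype, hammingNorm, ← card_univ,
      ← card_filter_add_card_filter_not (s := univ) (f · = 0), Nat.add_sub_cancel]
  have hone : Fintype.card {a // f a = 1} = hammingNorm f := by
    have eq_one_iff : ∀ x : ZMod 2, x = 1 ↔ x ≠ 0 := by decide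
    simp only [Fintype.card_subtype, hammingNorm, eq_one_iff]
  rw [Nat.card_eq_fintype_card, DomMulAct.stabilizer_card, mul_comm, ← hzero, ← hone]
  exact Fin.prod_univ_two _

theorem pow_mul_factorial_le_pow_mul_descFactorial {n d : ℕ} (h : d ≤ n) :
    n ^ d * d.factorial ≤ d ^ d * n.descFactorial d := by
  rw [← Nat.descFactorial_self, Nat.descFactorial_eq_prod_range, Nat.descFactorial_eq_prod_range,
    pow_eq_prod_const, pow_eq_prod_const, ← prod_mul_distrib, ← prod_mul_distrib]
  refine prod_le_prod' fun i _ => ?_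
  rw [Nat.mul_sub, Nat.mul_sub, mul_comm n d]
  exact Nat.sub_le_sub_left (Nat.mul_le_mul_right i h) _

theorem card_perm_comp_symm_eq_div_le_pow {α : Type*} [Fintype α] (f h : α → ZMod 2) {t : ℝ}
    (ht : hammingNorm f ≤ t * Fintype.card α) :
    (Nat.card {σ : Equiv.Perm α // f ∘ σ.symm = h} : ℝ) / (Fintype.card α).factorial
      ≤ t ^ hammingNorm f := by
  set n := Fintype.card α
  set d := hammingNorm f
  have hdn : d ≤ n := hammingNorm_le_card_fintype
  have hcard : (Nat.card {σ : Equiv.Perm α // f ∘ σ.symm = h} : ℝ)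
      ≤ d.factorial * (n - d).factorial := by
    exact_mod_cast (card_perm_comp_symm_eq_le f h).trans_eq (card_perm_comp_eq_self f)
  have hpow : (0 : ℝ) < n ^ d := mod_cast Nat.pos_of_ne_zero fun h0 => by
    rw [pow_eq_zero_iff'] at h0
    lia
  have hfactorial : (d.factorial : ℝ) ≤ t ^ d * n.descFactorial d := by
    refine le_of_mul_le_mul_left ?_ hpow
    calc (n : ℝ) ^ d * d.factorial ≤ d ^ d * n.descFactorial d :=
          mod_cast pow_mul_factorial_le_pow_mul_descFactorial hdn
      _ ≤ (t * n) ^ d * n.descFactorial d := by gcongr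
      _ = n ^ d * (t ^ d * n.descFactorial d) := by ring
  rw [div_le_iff₀ (by positivity), ← Nat.factorial_mul_descFactorial hdn]
  calc _ ≤ (d.factorial : ℝ) * (n - d).factorial := hcard
    _ ≤ t ^ d * n.descFactorial d * (n - d).factorial := by gcongr
    _ = _ := by push_cast; ring

theorem sum_pow_hammingNorm_le_exp {ι M : Type*} [Fintype ι] [DecidableEq ι] [Fintype M]
    [DecidableEq M] [Zero M] {t : ℝ} (ht : 0 ≤ t) :
    ∑ g : ι → M, t ^ hammingNorm g ≤ Real.exp (Fintype.card ι * Fintype.card M * t) := by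
  have hsymbol : ∑ y : M, (if y ≠ 0 then t else 1) ≤ Real.exp (Fintype.card M * t) :=
    calc ∑ y : M, (if y ≠ 0 then t else 1) ≤ ∑ y : M, (t + if y = 0 then 1 else 0) := by
          gcongr with y
          split_ifs <;> simp_all
      _ = Fintype.card M * t + 1 := by simp [sum_add_distrib]
      _ ≤ _ := Real.add_one_le_exp _
  calc ∑ g : ι → M, t ^ hammingNorm g = ∑ g : ι → M, ∏ i, (if g i ≠ 0 then t else 1) := by
        simp [hammingNorm, prod_ite]
    _ = ∏ _i : ι, ∑ y : M, (if y ≠ 0 then t else 1) :=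
        (Fintype.prod_sum fun (_ : ι) (y : M) => if y ≠ 0 then t else 1).symm
    _ ≤ ∏ _i : ι, Real.exp (Fintype.card M * t) := by
        gcongr with i
    _ = _ := by simp [← Real.exp_nat_mul, mul_assoc]

end Counting

section HammingNorm

variable {ι κ M : Type*} [Fintype ι]

theorem hammingNorm_prod [Fintype κ] [DecidableEq M] [Zero M] (c : ι × κ → M) :
    hammingNorm c = ∑ i, hammingNorm fun k => c (i, k) := by
  simp only [hammingNorm, card_filter, Fintype.sum_prod_type]

theorem hammingNorm_comp_equiv [Fintype κ] [DecidableEq M] [Zero M] (e : ι ≃ κ) (c : κ → M) :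
    hammingNorm (c ∘ e) = hammingNorm c := by
  simp only [hammingNorm, card_filter]
  exact e.sum_comp fun k => if c k ≠ 0 then 1 else 0

theorem mul_hammingNorm_le_sum [DecidableEq M] [Zero M] {g : ι → M} {a : ℕ} {ω : ι → ℕ}
    (h : ∀ i, g i ≠ 0 → a ≤ ω i) : a * hammingNorm g ≤ ∑ i, ω i := by
  calc a * hammingNorm g = ∑ i with g i ≠ 0, a := by simp [hammingNorm, mul_comm]
    _ ≤ ∑ i with g i ≠ 0, ω i := sum_le_sum fun i hi => h i (mem_filter.1 hi).2
    _ ≤ ∑ i, ω i := sum_le_sum_of_subset (filter_subset _ _)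

theorem exists_ne_ne_zero_of_sum_eq_zero [AddCommMonoid M] {v : ι → M} (hsum : ∑ i, v i = 0)
    {i : ι} (hi : v i ≠ 0) : ∃ j ≠ i, v j ≠ 0 := by
  by_contra! h
  exact hi ((Fintype.sum_eq_single i h).symm.trans hsum)

theorem two_le_hammingNorm_of_sum_eq_zero [DecidableEq M] [AddCommMonoid M] {v : ι → M}
    (hsum : ∑ i, v i = 0) (hv : v ≠ 0) : 2 ≤ hammingNorm v := by
  obtain ⟨i, hi⟩ := Function.ne_iff.1 hv
  obtain ⟨j, hji, hj⟩ := exists_ne_ne_zero_of_sum_eq_zero hsum hi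
  exact one_lt_card.2 ⟨i, by simpa using hi, j, by simpa using hj, hji.symm⟩

theorem three_le_hammingNorm_of_mulVec_eq_zero {H : Matrix κ ι (ZMod 2)}
    (hinj : Function.Injective H.col) (hne : ∀ t, H.col t ≠ 0) {w : ι → ZMod 2}
    (hw : H.mulVec w = 0) (hw0 : w ≠ 0) : 3 ≤ hammingNorm w := by
  have hsum : ∑ t, w t • H.col t = 0 := by
    ext k
    simpa [Matrix.mulVec, dotProduct, mul_comm] using congrFun hw k
  have hterm : ∀ {t}, w t • H.col t ≠ 0 ↔ w t ≠ 0 := by simp [hne]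
  have eq_one_of_ne_zero : ∀ x : ZMod 2, x ≠ 0 → x = 1 := by decide
  obtain ⟨i, hi⟩ := Function.ne_iff.1 hw0
  obtain ⟨j, hji, hj⟩ := exists_ne_ne_zero_of_sum_eq_zero hsum (hterm.2 hi)
  rw [hterm] at hj
  obtain ⟨k, hki, hkj, hk⟩ : ∃ k, k ≠ i ∧ k ≠ j ∧ w k ≠ 0 := by
    by_contra! h
    rw [Fintype.sum_eq_add i j hji.symm fun k hk => by simp [h k hk.1 hk.2],
      eq_one_of_ne_zero _ hi, eq_one_of_ne_zero _ hj, one_smul, one_smul] at hsum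
    exact hji (hinj (funext fun r => (CharTwo.add_eq_zero.1 (congrFun hsum r)).symm))
  exact two_lt_card.2 ⟨i, by simpa using hi, j, by simpa using hj, k, by simpa using hk,
    hji.symm, hki.symm, hkj.symm⟩

end HammingNorm

theorem exists_pos_forall_mul_norm_le {E : Type*} [NormedAddCommGroup E] [NormedSpace ℝ E]
    [ProperSpace E] {K : Set E} (hclosed : IsClosed K)
    (hsmul : ∀ r : ℝ, 0 ≤ r → ∀ x ∈ K, r • x ∈ K) (f : E →L[ℝ] ℝ)
    (hf : ∀ x ∈ K, x ≠ 0 → 0 < f x) : ∃ ε > 0, ∀ x ∈ K, ε * ‖x‖ ≤ f x := by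
  obtain ⟨ε, hε, hle⟩ := ((isCompact_sphere (0 : E) 1).inter_left hclosed).exists_forall_le'
    f.continuous.continuousOn fun x hx => hf x hx.1 (ne_zero_of_mem_unit_sphere ⟨x, hx.2⟩)
  refine ⟨ε, hε, fun x hx => ?_⟩
  obtain rfl | hx0 := eq_or_ne x 0
  · simp
  have hunit : ‖x‖⁻¹ • x ∈ Metric.sphere (0 : E) 1 := by simp [norm_smul, hx0]
  have := hle _ ⟨hsmul _ (by positivity) x hx, hunit⟩
  rwa [map_smul, smul_eq_mul, inv_mul_eq_div, le_div_iff₀ (norm_pos_iff.2 hx0)] at this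

theorem exists_subsingleton_neighborSet_inter {V : Type*} [Finite V] {G : SimpleGraph V}
    (hG : G.IsAcyclic) {A : Set V} (hA : A.Nonempty) :
    ∃ v ∈ A, (G.neighborSet v ∩ A).Subsingleton := by
  have : Nonempty A := hA.to_subtype
  obtain ⟨u, v, p, hp, hmax⟩ :=
    SimpleGraph.Walk.exists_isPath_forall_isPath_length_le_length (G.induce A)
  have hpenultimate : ∀ w, (G.induce A).Adj v w → w = p.penultimate := fun w hw => by
    by_cases hs : w ∈ p.support
    · exact (hG.induce A).eq_penultimate_of_adj_end hp hw hs
    · simpa using hmax _ _ _ (hp.concat hs hw)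
  exact ⟨v, v.2, fun a ha b hb => congrArg Subtype.val
    ((hpenultimate ⟨a, ha.2⟩ ha.1).trans (hpenultimate ⟨b, hb.2⟩ hb.1).symm)⟩

section Edge

variable {nc nv : ℕ} {B : Matrix (Fin nc) (Fin nv) ℕ}

-- `Matrix` does not unfold during instance search, so `Fintype (Fin (B i j))` is given by hand.
instance (i : Fin nc) : Fintype (Σ j, Fin (B i j)) :=
  @Sigma.instFintype _ _ (fun j => Fin.fintype (B i j)) _

instance : Fintype (Edge B) :=
  Sigma.instFintype

instance (i : Fin nc) : DecidableEq (Σ j, Fin (B i j)) :=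
  @Sigma.instDecidableEqSigma _ _ _ fun j => instDecidableEqFin (B i j)

instance : DecidableEq (Edge B) :=
  Sigma.instDecidableEqSigma

theorem sum_edge {M : Type*} [AddCommMonoid M] (f : Edge B → M) :
    ∑ e, f e = ∑ i, ∑ j, ∑ k, f ⟨i, j, k⟩ :=
  (Fintype.sum_sigma f).trans (sum_congr rfl fun _ _ => Fintype.sum_sigma _)

theorem sum_edge_varNode {M : Type*} [AddCommMonoid M] (f : Fin nv → M) :
    ∑ e : Edge B, f e.2.1 = ∑ j, varDegree B j • f j := by
  simp only [sum_edge, sum_const, card_univ, Fintype.card_fin, varDegree, sum_smul]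
  exact sum_comm

end Edge

section Probability

variable {nc nv : ℕ} {B : Matrix (Fin nc) (Fin nv) ℕ} {μ β : ℕ}

theorem liftingProb_nonneg (P : Lifting B μ β → Prop) : 0 ≤ liftingProb B μ β P := by
  unfold liftingProb
  positivity

theorem liftingProb_mono {P Q : Lifting B μ β → Prop} (h : ∀ π, P π → Q π) :
    liftingProb B μ β P ≤ liftingProb B μ β Q := by
  unfold liftingProb
  gcongr
  exact Nat.card_le_card_of_injective _ (Subtype.map_injective h Function.injective_id)

theorem liftingProb_exists_mem_le {X : Type*} (s : Finset X) (P : X → Lifting B μ β → Prop) :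
    liftingProb B μ β (fun π => ∃ x ∈ s, P x π) ≤ ∑ x ∈ s, liftingProb B μ β (P x) := by
  classical
  simp only [liftingProb, ← sum_div]
  gcongr
  have hunion : univ.filter (fun π => ∃ x ∈ s, P x π) = s.biUnion fun x => univ.filter (P x) := by
    ext
    simp
  simp only [Nat.card_eq_fintype_card, Fintype.card_subtype, hunion]
  exact_mod_cast card_biUnion_le

theorem liftingProb_forall_edge (P : Edge B → Equiv.Perm (Copy μ β) → Prop) :
    liftingProb B μ β (fun π => ∀ e, P e (π e))
      = ∏ e, (Nat.card {σ // P e σ} : ℝ) / Nat.card (Equiv.Perm (Copy μ β)) := by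
  rw [liftingProb, Nat.card_congr (Equiv.subtypePiEquivPi (p := fun e σ => P e σ)), Nat.card_pi,
    Nat.card_pi, prod_div_distrib, Nat.cast_prod, Nat.cast_prod]

end Probability

section CheckInput

variable {nc nv : ℕ} {B : Matrix (Fin nc) (Fin nv) ℕ} {D : Finset (Fin nv)} {μ β : ℕ}
  {C : Submodule (ZMod 2) (Fin μ → ZMod 2)} {c : Fin nv × Copy μ β → ZMod 2} {π : Lifting B μ β}

/-- The Hamming weight of the part of the word `c` carried by the copies of the variable node
`j`. -/
def nodeWeight (c : Fin nv × Copy μ β → ZMod 2) (j : Fin nv) : ℕ :=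
  hammingNorm fun s => c (j, s)

theorem sum_nodeWeight (c : Fin nv × Copy μ β → ZMod 2) : ∑ j, nodeWeight c j = hammingNorm c :=
  (hammingNorm_prod c).symm

theorem hammingNorm_nodeWord_symm (c : Fin nv × Copy μ β → ZMod 2) (j : Fin nv)
    (σ : Equiv.Perm (Copy μ β)) : hammingNorm (fun s => c (j, σ.symm s)) = nodeWeight c j :=
  hammingNorm_comp_equiv σ.symm fun s => c (j, s)

/-- The symbols that the copies of the edges deliver to the copy `x` of a check node when the word
`c` is transmitted; the entry of an edge with a different check node is `0`. -/
def checkInput (c : Fin nv × Copy μ β → ZMod 2) (π : Lifting B μ β) (x : Fin nc × Copy μ β) :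
    Edge B → ZMod 2 :=
  fun e => if e.1 = x.1 then c (e.2.1, (π e).symm x.2) else 0

theorem sum_checkInput_eq_zero (hc : c ∈ code D C π) (x : Fin nc × Copy μ β) :
    ∑ e, checkInput c π x e = 0 := by
  rw [← hc.1 x.1 x.2]
  simp only [checkInput, sum_edge]
  rw [Fintype.sum_eq_single x.1 fun i hi => by simp [hi]]
  simp

theorem sum_hammingNorm_checkInput (c : Fin nv × Copy μ β → ZMod 2) (π : Lifting B μ β)
    (i : Fin nc) : ∑ s, hammingNorm (checkInput c π (i, s)) = ∑ j, B i j * nodeWeight c j := by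
  calc ∑ s, hammingNorm (checkInput c π (i, s))
      = ∑ j, ∑ k, hammingNorm fun s => c (j, (π ⟨i, j, k⟩).symm s) := by
        simp only [hammingNorm, card_filter]
        rw [sum_comm, sum_edge, Fintype.sum_eq_single i fun i' hi => by simp [checkInput, hi]]
        simp only [checkInput, if_true]
    _ = _ := by simp [hammingNorm_nodeWord_symm]

theorem two_mul_hammingNorm_checkInput_le (hc : c ∈ code D C π) :
    2 * hammingNorm (checkInput c π) ≤ ∑ j, varDegree B j * nodeWeight c j :=
  calc 2 * hammingNorm (checkInput c π) ≤ ∑ x, hammingNorm (checkInput c π x) :=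
        mul_hammingNorm_le_sum fun x => two_le_hammingNorm_of_sum_eq_zero
          (sum_checkInput_eq_zero hc x)
    _ = ∑ i, ∑ j, B i j * nodeWeight c j := by
        rw [Fintype.sum_prod_type]
        exact sum_congr rfl fun i _ => sum_hammingNorm_checkInput c π i
    _ = _ := by
        rw [sum_comm]
        simp only [varDegree, sum_mul]

theorem liftingProb_checkInput_eq_le_pow {t : ℝ} (hc : hammingNorm c ≤ t * (β * μ))
    (g : Fin nc × Copy μ β → Edge B → ZMod 2) :
    liftingProb B μ β (fun π => checkInput c π = g)
      ≤ t ^ ∑ j, varDegree B j * nodeWeight c j := by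
  let P (e : Edge B) (σ : Equiv.Perm (Copy μ β)) : Prop :=
    (fun s => c (e.2.1, s)) ∘ σ.symm = fun s => g (e.1, s) e
  have hP : ∀ e, (Nat.card {σ // P e σ} : ℝ) / Nat.card (Equiv.Perm (Copy μ β))
      ≤ t ^ nodeWeight c e.2.1 := fun e => by
    rw [Nat.card_perm, Nat.card_eq_fintype_card (α := Copy μ β)]
    refine card_perm_comp_symm_eq_div_le_pow _ _ (le_trans ?_ (hc.trans_eq (by simp)))
    exact_mod_cast (single_le_sum_of_canonicallyOrdered (mem_univ _)).trans_eq (sum_nodeWeight c)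
  calc _ ≤ liftingProb B μ β fun π => ∀ e, P e (π e) :=
        liftingProb_mono fun π hπ e => funext fun s => by simp [← hπ, checkInput]
    _ = ∏ e, (Nat.card {σ // P e σ} : ℝ) / Nat.card (Equiv.Perm (Copy μ β)) :=
        liftingProb_forall_edge P
    _ ≤ ∏ e : Edge B, t ^ nodeWeight c e.2.1 := by
        gcongr with e
        exact hP e
    _ = _ := by simp only [prod_pow_eq_pow_sum, sum_edge_varNode, smul_eq_mul]

theorem liftingProb_mem_code_le {t : ℝ} (ht0 : 0 < t) (ht1 : t ≤ 1)
    (hc : hammingNorm c ≤ t * (β * μ)) :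
    liftingProb B μ β (fun π => c ∈ code D C π)
      ≤ Real.exp (nc * Fintype.card (Edge B → ZMod 2) * (t * (β * μ)))
        * t ^ ((∑ j, varDegree B j * nodeWeight c j : ℕ) / 2 : ℝ) := by
  set T := ∑ j, varDegree B j * nodeWeight c j
  let sparse : Finset (Fin nc × Copy μ β → Edge B → ZMod 2) := {g | 2 * hammingNorm g ≤ T}
  calc _ ≤ liftingProb B μ β fun π => ∃ g ∈ sparse, checkInput c π = g :=
        liftingProb_mono fun π hπ =>
          ⟨_, mem_filter_univ _ |>.2 (two_mul_hammingNorm_checkInput_le hπ), rfl⟩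
    _ ≤ ∑ _g ∈ sparse, t ^ T := (liftingProb_exists_mem_le _ _).trans
        (sum_le_sum fun g _ => liftingProb_checkInput_eq_le_pow hc g)
    _ ≤ ∑ g ∈ sparse, t ^ hammingNorm g * t ^ (T / 2 : ℝ) := by
        refine sum_le_sum fun g hg => ?_
        have hg : (2 * hammingNorm g : ℝ) ≤ T := mod_cast (mem_filter.1 hg).2
        rw [← Real.rpow_natCast, ← Real.rpow_natCast, ← Real.rpow_add ht0]
        exact Real.rpow_le_rpow_of_exponent_ge ht0 ht1 (by linarith)
    _ ≤ ∑ g, t ^ hammingNorm g * t ^ (T / 2 : ℝ) :=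
        sum_le_sum_of_subset_of_nonneg (subset_univ _) fun _ _ _ => by positivity
    _ ≤ _ := by
        rw [← sum_mul]
        gcongr
        exact (sum_pow_hammingNorm_le_exp ht0.le).trans_eq (by simp; ring_nf)

end CheckInput

section Balanced

variable {nc nv : ℕ} {B : Matrix (Fin nc) (Fin nv) ℕ} {D : Finset (Fin nv)}

/-- The inequalities that the check nodes impose on the weights `d` of a codeword on the variable
nodes: at a check node, an edge carries at most half of the total weight of all edges. -/
def IsBalanced (B : Matrix (Fin nc) (Fin nv) ℕ) (d : Fin nv → ℝ) : Prop :=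
  ∀ i j, B i j ≠ 0 → 2 * d j ≤ ∑ j', B i j' * d j'

theorem isBalanced_nodeWeight {μ β : ℕ} {C : Submodule (ZMod 2) (Fin μ → ZMod 2)}
    {c : Fin nv × Copy μ β → ZMod 2} {π : Lifting B μ β} (hc : c ∈ code D C π) :
    IsBalanced B fun j => (nodeWeight c j : ℝ) := by
  intro i j hij
  let e : Edge B := ⟨i, j, ⟨0, Nat.pos_of_ne_zero hij⟩⟩
  have hle : 2 * nodeWeight c j ≤ ∑ s, hammingNorm (checkInput c π (i, s)) := by
    rw [← hammingNorm_nodeWord_symm c j (π e)]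
    refine mul_hammingNorm_le_sum fun s hs =>
      two_le_hammingNorm_of_sum_eq_zero (sum_checkInput_eq_zero hc (i, s)) fun h0 => hs ?_
    simpa [checkInput, e] using congrFun h0 e
  rw [sum_hammingNorm_checkInput] at hle
  beta_reduce
  exact_mod_cast hle

theorem IsBalanced.exists_ne {d : Fin nv → ℝ} (hb : IsBalanced B d) (hd : 0 ≤ d) {i : Fin nc}
    {j : Fin nv} (hj : d j ≠ 0) (hij : B i j = 1) : ∃ j' ≠ j, B i j' ≠ 0 ∧ d j' ≠ 0 := by
  by_contra! h
  have hle := hb i j (by simp [hij])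
  rw [Fintype.sum_eq_single j fun j' hj' => by simpa [or_iff_not_imp_left] using h j' hj'] at hle
  have hpos : 0 < d j := (hd j).lt_of_ne' hj
  simp only [hij, Nat.cast_one, one_mul] at hle
  linarith

theorem undopedDegTwoGraph_adj {i : Fin nc} {j : Fin nv} (hj : IsUndopedDegTwo B D j)
    (hij : B i j ≠ 0) : (undopedDegTwoGraph B D).Adj (Sum.inl j) (Sum.inr i) :=
  (SimpleGraph.fromRel_adj ..).2 ⟨by simp, Or.inl ⟨j, i, rfl, rfl, hj, hij⟩⟩

theorem exists_ne_of_isUndopedDegTwo {j : Fin nv} (hj : IsUndopedDegTwo B D j)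
    (hsimple : ∀ i, B i j ≤ 1) : ∃ i i', i ≠ i' ∧ B i j ≠ 0 ∧ B i' j ≠ 0 := by
  have hcard : 1 < #{i | B i j ≠ 0} :=
    calc 1 < varDegree B j := one_lt_two.trans_eq hj.2.symm
      _ = ∑ i with B i j ≠ 0, B i j := (sum_filter_ne_zero _).symm
      _ ≤ #{i | B i j ≠ 0} := by simpa using sum_le_card_nsmul _ _ 1 fun i _ => hsimple i
  obtain ⟨i, hi, i', hi', hne⟩ := one_lt_card.1 hcard
  exact ⟨i, i', hne, (mem_filter.1 hi).2, (mem_filter.1 hi').2⟩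

theorem IsBalanced.eq_zero (hcycle : NoUndopedDegTwoCycle B D) {d : Fin nv → ℝ} (hd : 0 ≤ d)
    (hb : IsBalanced B d) (hsupp : ∀ j, ¬ IsUndopedDegTwo B D j → d j = 0) : d = 0 := by
  obtain ⟨hsimple, hacyclic⟩ := hcycle
  by_contra hne
  obtain ⟨j₀, hj₀⟩ := Function.ne_iff.1 hne
  have hweak : ∀ {j}, d j ≠ 0 → IsUndopedDegTwo B D j := fun hj => not_not.1 (mt (hsupp _) hj)
  have hadj : ∀ {i j}, d j ≠ 0 → B i j ≠ 0 →
      (undopedDegTwoGraph B D).Adj (Sum.inl j) (Sum.inr i) := fun hj =>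
    undopedDegTwoGraph_adj (hweak hj)
  let A : Set (Fin nv ⊕ Fin nc) :=
    Sum.inl '' {j | d j ≠ 0} ∪ Sum.inr '' {i | ∃ j, d j ≠ 0 ∧ B i j ≠ 0}
  obtain ⟨v, ⟨j, hj, rfl⟩ | ⟨i, ⟨j, hj, hij⟩, rfl⟩, hv⟩ :=
    exists_subsingleton_neighborSet_inter hacyclic (A := A) ⟨_, Or.inl ⟨j₀, hj₀, rfl⟩⟩
  · obtain ⟨i, i', hii', hi, hi'⟩ := exists_ne_of_isUndopedDegTwo (hweak hj) fun i =>
      hsimple i j (hweak hj)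
    exact hii' (Sum.inr_injective (hv ⟨hadj hj hi, Or.inr ⟨i, ⟨j, hj, hi⟩, rfl⟩⟩
      ⟨hadj hj hi', Or.inr ⟨i', ⟨j, hj, hi'⟩, rfl⟩⟩))
  · obtain ⟨j', hjj', hij', hj'⟩ := hb.exists_ne hd hj
      ((hsimple i j (hweak hj)).antisymm (Nat.one_le_iff_ne_zero.2 hij))
    exact hjj' (Sum.inl_injective (hv ⟨(hadj hj' hij').symm, Or.inl ⟨j', hj', rfl⟩⟩
      ⟨(hadj hj hij).symm, Or.inl ⟨j, hj, rfl⟩⟩))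

theorem isClosed_setOf_isBalanced : IsClosed {d | IsBalanced B d} := by
  simp only [IsBalanced, Set.ofPred_forall]
  exact isClosed_iInter fun i => isClosed_iInter fun j => isClosed_iInter fun _ =>
    isClosed_le (by fun_prop) (by fun_prop)

theorem IsBalanced.smul {d : Fin nv → ℝ} (hb : IsBalanced B d) {r : ℝ} (hr : 0 ≤ r) :
    IsBalanced B (r • d) := fun i j hij => by
  calc 2 * (r * d j) = r * (2 * d j) := by ring
    _ ≤ r * ∑ j', B i j' * d j' := by gcongr; exact hb i j hij
    _ = _ := by
        rw [mul_sum]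
        exact sum_congr rfl fun j' _ => mul_left_comm _ _ _

theorem exists_pos_forall_mul_sum_le_sum_filter [DecidablePred (IsUndopedDegTwo B D)]
    (hcycle : NoUndopedDegTwoCycle B D) :
    ∃ ε > 0, ∀ d : Fin nv → ℝ, 0 ≤ d → IsBalanced B d →
      ε * ∑ j, d j ≤ ∑ j with ¬ IsUndopedDegTwo B D j, d j := by
  let f : (Fin nv → ℝ) →L[ℝ] ℝ :=
    ∑ j with ¬ IsUndopedDegTwo B D j, ContinuousLinearMap.proj j
  have hf : ∀ d, f d = ∑ j with ¬ IsUndopedDegTwo B D j, d j := by simp [f]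
  obtain ⟨ε, hε, hle⟩ := exists_pos_forall_mul_norm_le (K := {d | 0 ≤ d ∧ IsBalanced B d})
    (isClosed_Ici.inter isClosed_setOf_isBalanced)
    (fun r hr d hd => ⟨smul_nonneg hr hd.1, hd.2.smul hr⟩) f fun d ⟨hd, hb⟩ hd0 => by
      rw [hf]
      refine (sum_nonneg fun j _ => hd j).lt_of_ne' fun hsum => hd0 (hb.eq_zero hcycle hd ?_)
      simpa using (sum_eq_zero_iff_of_nonneg fun j _ => hd j).1 hsum
  refine ⟨ε / (nv + 1), by positivity, fun d hd hb => ?_⟩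
  have hnorm : ∑ j, d j ≤ nv * ‖d‖ := by
    simpa [abs_of_nonneg (hd _)] using Pi.sum_norm_apply_le_norm d
  calc ε / (nv + 1) * ∑ j, d j ≤ ε / (nv + 1) * ((nv + 1) * ‖d‖) := by
        gcongr
        linarith [norm_nonneg d]
    _ = ε * ‖d‖ := by field_simp
    _ ≤ _ := (hle d ⟨hd, hb⟩).trans_eq (hf d)

end Balanced

section MinDist

theorem minDist_le {ι : Type*} [Fintype ι] {E : Submodule (ZMod 2) (ι → ZMod 2)} {c : ι → ZMod 2}
    (hc : c ∈ E) (hc0 : c ≠ 0) : minDist E ≤ hammingNorm c :=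
  iInf₂_le_of_le c hc (iInf_le _ hc0)

theorem exists_hammingNorm_lt_of_minDist_lt {ι : Type*} [Fintype ι]
    {E : Submodule (ZMod 2) (ι → ZMod 2)} {x : ℝ}
    (h : (minDist E : ℝ≥0∞) < ENNReal.ofReal x) : ∃ c ∈ E, c ≠ 0 ∧ hammingNorm c < x := by
  simp only [minDist, ENat.toENNReal_iInf, iInf_lt_iff, ENat.toENNReal_coe] at h
  obtain ⟨c, hc, hc0, hlt⟩ := h
  exact ⟨c, hc, hc0, by simpa using ENNReal.lt_ofReal_iff_toReal_lt (by simp) |>.1 hlt⟩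

theorem IsHammingCode.three_le_minDist {μ κ : ℕ} {C : Submodule (ZMod 2) (Fin μ → ZMod 2)}
    (hC : IsHammingCode κ C) : 3 ≤ minDist C := by
  obtain ⟨r, -, -, H, ⟨hinj, hrange⟩, hmem⟩ := hC
  have hne : ∀ t, H.col t ≠ 0 := fun t => hrange.subset (Set.mem_range_self t)
  refine le_iInf₂ fun w hw => le_iInf fun hw0 => ?_
  exact_mod_cast three_le_hammingNorm_of_mulVec_eq_zero hinj hne ((hmem w).1 hw) hw0

end MinDist

section Blocks

variable {nc nv : ℕ} {B : Matrix (Fin nc) (Fin nv) ℕ} {D : Finset (Fin nv)} {μ β : ℕ}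
  {C : Submodule (ZMod 2) (Fin μ → ZMod 2)} {c : Fin nv × Copy μ β → ZMod 2} {π : Lifting B μ β}

/-- The blocks of the word `c` on the copies of the variable nodes, as one word over the alphabet
`Fin μ → ZMod 2`; its Hamming weight is the number of nonzero blocks. -/
def blocks (c : Fin nv × Copy μ β → ZMod 2) : Fin nv × Fin β → Fin μ → ZMod 2 :=
  fun p t => c (p.1, (p.2, t))

theorem mul_hammingNorm_blocks_le {a q : ℕ} {j : Fin nv}
    (h : ∀ b, blocks c (j, b) ≠ 0 → a ≤ q * hammingNorm (blocks c (j, b))) :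
    a * hammingNorm (fun b => blocks c (j, b)) ≤ q * nodeWeight c j :=
  (mul_hammingNorm_le_sum h).trans_eq (by rw [← mul_sum, nodeWeight, hammingNorm_prod]; rfl)

theorem three_le_varDegree_mul_hammingNorm {j : Fin nv} (hj : ¬ IsUndopedDegTwo B D j)
    (hundoped : j ∉ D → 2 ≤ varDegree B j)
    (hdoped : j ∈ D → 2 < (varDegree B j : ℕ∞) * minDist C)
    {w : Fin μ → ZMod 2} (hw : j ∈ D → w ∈ C) (hw0 : w ≠ 0) :
    3 ≤ varDegree B j * hammingNorm w := by
  by_cases hjD : j ∈ D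
  · have hlt : (2 : ℕ∞) < varDegree B j * hammingNorm w :=
      (hdoped hjD).trans_le (by gcongr; exact minDist_le (hw hjD) hw0)
    exact_mod_cast Order.add_one_le_of_lt hlt
  · have hdeg : 3 ≤ varDegree B j := (hundoped hjD).lt_of_ne' fun h => hj ⟨hjD, h⟩
    exact hdeg.trans (Nat.le_mul_of_pos_right _ (hammingNorm_pos_iff.2 hw0))

theorem six_mul_hammingNorm_blocks_add_le [DecidablePred (IsUndopedDegTwo B D)]
    (hundoped : ∀ j ∉ D, 2 ≤ varDegree B j)
    (hdoped : ∀ j ∈ D, 2 < (varDegree B j : ℕ∞) * minDist C) (hc : c ∈ code D C π) :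
    6 * hammingNorm (blocks c) + ∑ j with ¬ IsUndopedDegTwo B D j, nodeWeight c j
      ≤ 3 * ∑ j, varDegree B j * nodeWeight c j := by
  rw [hammingNorm_prod, mul_sum, sum_filter, ← sum_add_distrib, mul_sum]
  gcongr with j
  split_ifs with hj
  · have h1 : 1 * hammingNorm (fun b => blocks c (j, b)) ≤ 1 * nodeWeight c j :=
      mul_hammingNorm_blocks_le fun b hb => (hammingNorm_pos_iff.2 hb).trans_eq (one_mul _).symm
    rw [hj.2]
    lia
  · have h3 : 3 * hammingNorm (fun b => blocks c (j, b)) ≤ varDegree B j * nodeWeight c j :=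
      mul_hammingNorm_blocks_le fun b => three_le_varDegree_mul_hammingNorm hj (hundoped j)
        (hdoped j) fun hjD => hc.2 j hjD b
    have hdeg : nodeWeight c j ≤ varDegree B j * nodeWeight c j := by
      refine Nat.le_mul_of_pos_left _ (Nat.pos_of_ne_zero fun h0 => ?_)
      by_cases hjD : j ∈ D
      · simpa [h0] using hdoped j hjD
      · simpa [h0] using hundoped j hjD
    lia

theorem exists_pos_forall_hammingNorm_blocks_add_le (hundoped : ∀ j ∉ D, 2 ≤ varDegree B j)
    (hdoped : ∀ j ∈ D, 2 < (varDegree B j : ℕ∞) * minDist C)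
    (hcycle : NoUndopedDegTwoCycle B D) :
    ∃ a > (0 : ℝ), ∀ (β : ℕ) (π : Lifting B μ β), ∀ c ∈ code D C π,
      hammingNorm (blocks c) + a * hammingNorm c
        ≤ (∑ j, varDegree B j * nodeWeight c j : ℕ) / 2 := by
  classical
  obtain ⟨ε, hε, hle⟩ := exists_pos_forall_mul_sum_le_sum_filter hcycle
  refine ⟨ε / 6, by positivity, fun β π c hc => ?_⟩
  have hstrong : ε * hammingNorm c
      ≤ (∑ j with ¬ IsUndopedDegTwo B D j, nodeWeight c j : ℕ) := by
    rw [← sum_nodeWeight]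
    exact_mod_cast hle _ (fun j => Nat.cast_nonneg _) (isBalanced_nodeWeight hc)
  have hblocks : (6 * hammingNorm (blocks c)
      + (∑ j with ¬ IsUndopedDegTwo B D j, nodeWeight c j : ℕ) : ℝ)
      ≤ 3 * (∑ j, varDegree B j * nodeWeight c j : ℕ) :=
    mod_cast six_mul_hammingNorm_blocks_add_le hundoped hdoped hc
  linarith

end Blocks

section WeightEnumerator

variable {nc nv : ℕ} {B : Matrix (Fin nc) (Fin nv) ℕ} {D : Finset (Fin nv)} {μ : ℕ}
  {C : Submodule (ZMod 2) (Fin μ → ZMod 2)}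

theorem sum_pow_hammingNorm_blocks_le_exp (nv μ β : ℕ) {t : ℝ} (ht : 0 ≤ t) :
    ∑ c : Fin nv × Copy μ β → ZMod 2, t ^ hammingNorm (blocks c)
      ≤ Real.exp (nv * Fintype.card (Fin μ → ZMod 2) * (t * β)) := by
  let curry : (Fin nv × Copy μ β → ZMod 2) ≃ (Fin nv × Fin β → Fin μ → ZMod 2) :=
    ((Equiv.prodAssoc _ _ _).symm.arrowCongr (Equiv.refl _)).trans (Equiv.curry _ _ _)
  calc ∑ c : Fin nv × Copy μ β → ZMod 2, t ^ hammingNorm (blocks c) = ∑ g, t ^ hammingNorm g :=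
        curry.sum_comp fun g => t ^ hammingNorm g
    _ ≤ _ := (sum_pow_hammingNorm_le_exp ht).trans_eq (by simp; ring_nf)

theorem liftingProb_mem_code_le_pow_mul_pow {β : ℕ} {c : Fin nv × Copy μ β → ZMod 2} {a t : ℝ}
    (ha : ∀ π : Lifting B μ β, c ∈ code D C π →
      hammingNorm (blocks c) + a * hammingNorm c
        ≤ (∑ j, varDegree B j * nodeWeight c j : ℕ) / 2)
    (ht0 : 0 < t) (ht1 : t ≤ 1) (hc : hammingNorm c ≤ t * (β * μ)) :
    liftingProb B μ β (fun π => c ∈ code D C π)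
      ≤ Real.exp (nc * Fintype.card (Edge B → ZMod 2) * (t * (β * μ)))
        * (t ^ a) ^ hammingNorm c * t ^ hammingNorm (blocks c) := by
  by_cases hex : ∃ π : Lifting B μ β, c ∈ code D C π
  · obtain ⟨π, hπ⟩ := hex
    refine (liftingProb_mem_code_le ht0 ht1 hc).trans ?_
    rw [mul_assoc _ (_ ^ _), ← Real.rpow_mul_natCast ht0.le, ← Real.rpow_natCast,
      ← Real.rpow_add ht0]
    gcongr ?_ * ?_
    exact Real.rpow_le_rpow_of_exponent_ge ht0 ht1 ((add_comm _ _).trans_le (ha π hπ))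
  · push Not at hex
    have hzero : liftingProb B μ β (fun π => c ∈ code D C π) = 0 := by simp [liftingProb, hex]
    rw [hzero]
    positivity

theorem liftingProb_exists_hammingNorm_eq_le_of_le {β w : ℕ} {a t : ℝ}
    (ha : ∀ π : Lifting B μ β, ∀ c ∈ code D C π,
      hammingNorm (blocks c) + a * hammingNorm c
        ≤ (∑ j, varDegree B j * nodeWeight c j : ℕ) / 2)
    (ht0 : 0 < t) (ht1 : t ≤ 1) (hw : w ≤ t * (β * μ)) :
    liftingProb B μ β (fun π => ∃ c ∈ code D C π, hammingNorm c = w)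
      ≤ Real.exp (nc * Fintype.card (Edge B → ZMod 2) * (t * (β * μ))) * (t ^ a) ^ w
        * Real.exp (nv * Fintype.card (Fin μ → ZMod 2) * (t * β)) := by
  set A := Real.exp (nc * Fintype.card (Edge B → ZMod 2) * (t * (β * μ)))
  calc _ ≤ ∑ c : Fin nv × Copy μ β → ZMod 2 with hammingNorm c = w,
          liftingProb B μ β fun π => c ∈ code D C π :=
        (liftingProb_mono fun π ⟨c, hc, hcw⟩ => ⟨c, by simpa using hcw, hc⟩).trans
          (liftingProb_exists_mem_le _ _)
    _ ≤ ∑ c : Fin nv × Copy μ β → ZMod 2 with hammingNorm c = w,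
          A * (t ^ a) ^ w * t ^ hammingNorm (blocks c) := by
        refine sum_le_sum fun c hc => ?_
        obtain rfl := (mem_filter.1 hc).2
        exact liftingProb_mem_code_le_pow_mul_pow (ha · c) ht0 ht1 hw
    _ ≤ A * (t ^ a) ^ w * ∑ c : Fin nv × Copy μ β → ZMod 2, t ^ hammingNorm (blocks c) := by
        rw [← mul_sum]
        gcongr
        exact subset_univ _
    _ ≤ _ := by
        gcongr
        exact sum_pow_hammingNorm_blocks_le_exp nv μ β ht0.le

theorem liftingProb_exists_hammingNorm_eq_le {β w : ℕ} {a : ℝ}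
    (ha : ∀ π : Lifting B μ β, ∀ c ∈ code D C π,
      hammingNorm (blocks c) + a * hammingNorm c
        ≤ (∑ j, varDegree B j * nodeWeight c j : ℕ) / 2)
    (hw : 0 < w) (hwN : w ≤ β * μ) :
    liftingProb B μ β (fun π => ∃ c ∈ code D C π, hammingNorm c = w)
      ≤ (Real.exp (nc * Fintype.card (Edge B → ZMod 2) + nv * Fintype.card (Fin μ → ZMod 2))
        * (w / (β * μ : ℕ) : ℝ) ^ a) ^ w := by
  have hN : (0 : ℝ) < (β * μ : ℕ) := mod_cast hw.trans_le hwN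
  have hμ : (1 : ℝ) ≤ μ := mod_cast Nat.pos_of_mul_pos_left (hw.trans_le hwN)
  set t : ℝ := w / (β * μ : ℕ) with ht
  have ht0 : 0 < t := by positivity
  have ht1 : t ≤ 1 := (div_le_one hN).2 (mod_cast hwN)
  have htN : t * (β * μ) = w := by rw [ht, ← Nat.cast_mul, div_mul_cancel₀ _ hN.ne']
  have htβ : t * β ≤ w := by
    rw [← htN]
    gcongr
    exact le_mul_of_one_le_right (Nat.cast_nonneg β) hμ
  calc _ ≤ _ := liftingProb_exists_hammingNorm_eq_le_of_le ha ht0 ht1 htN.ge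
    _ ≤ Real.exp (nc * Fintype.card (Edge B → ZMod 2) * w) * (t ^ a) ^ w
          * Real.exp (nv * Fintype.card (Fin μ → ZMod 2) * w) := by
        rw [htN]
        gcongr
    _ = _ := by
        rw [mul_pow, ← Real.exp_nat_mul, mul_right_comm, ← Real.exp_add]
        ring_nf

theorem liftingProb_minDist_lt_le {β : ℕ} {a x : ℝ}
    (ha : ∀ π : Lifting B μ β, ∀ c ∈ code D C π,
      hammingNorm (blocks c) + a * hammingNorm c
        ≤ (∑ j, varDegree B j * nodeWeight c j : ℕ) / 2) (hx : x ≤ 1) :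
    liftingProb B μ β
        (fun π => (minDist (code D C π) : ℝ≥0∞) < ENNReal.ofReal (x * (β * μ : ℕ)))
      ≤ ∑ w ∈ Ico 1 ⌈x * (β * μ : ℕ)⌉₊,
        (Real.exp (nc * Fintype.card (Edge B → ZMod 2) + nv * Fintype.card (Fin μ → ZMod 2))
          * (w / (β * μ : ℕ) : ℝ) ^ a) ^ w := by
  calc _ ≤ liftingProb B μ β fun π =>
          ∃ w ∈ Ico 1 ⌈x * (β * μ : ℕ)⌉₊, ∃ c ∈ code D C π, hammingNorm c = w := by
        refine liftingProb_mono fun π hπ => ?_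
        obtain ⟨c, hc, hc0, hlt⟩ := exists_hammingNorm_lt_of_minDist_lt hπ
        exact ⟨_, mem_Ico.2 ⟨hammingNorm_pos_iff.2 hc0, Nat.lt_ceil.2 hlt⟩, c, hc, rfl⟩
    _ ≤ _ := liftingProb_exists_mem_le _ _
    _ ≤ _ := sum_le_sum fun w hw => by
        obtain ⟨hw1, hwx⟩ := mem_Ico.1 hw
        refine liftingProb_exists_hammingNorm_eq_le ha hw1 ?_
        exact_mod_cast (Nat.lt_ceil.1 hwx).le.trans (mul_le_of_le_one_left (Nat.cast_nonneg _) hx)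

end WeightEnumerator

section Tail

theorem exists_mul_rpow_lt_one (K : ℝ) {a : ℝ} (ha : 0 < a) :
    ∃ x > 0, x ≤ 1 ∧ K * x ^ a < 1 := by
  have hlim : Tendsto (fun x : ℝ => K * x ^ a) (𝓝[>] 0) (𝓝 0) := by
    have h := (Real.continuousAt_rpow_const 0 a (Or.inr ha.le)).tendsto.const_mul K
    rw [Real.zero_rpow ha.ne', mul_zero] at h
    exact h.mono_left nhdsWithin_le_nhds
  obtain ⟨x, hx, hx0, hx1⟩ :=
    ((hlim.eventually_lt_const one_pos).and (Ioc_mem_nhdsGT one_pos)).exists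
  exact ⟨x, hx0, hx1, hx⟩

theorem tendsto_sum_Ico_mul_rpow_pow {K a x : ℝ} (hK : 0 ≤ K) (ha : 0 < a) (hx : 0 ≤ x)
    (hKx : K * x ^ a < 1) :
    Tendsto (fun N : ℕ => ∑ w ∈ Ico 1 ⌈x * N⌉₊, (K * (w / N : ℝ) ^ a) ^ w) atTop (𝓝 0) := by
  rw [tendsto_congr fun N => sum_eq_tsum_indicator _ _, ← tsum_zero (α := ℝ) (β := ℕ)]
  refine tendsto_tsum_of_dominated_convergence (summable_geometric_of_lt_one (by positivity) hKx)
    (fun w => ?_) (.of_forall fun N w => ?_)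
  · obtain rfl | hw := eq_or_ne w 0
    · simp
    have hlim : Tendsto (fun N : ℕ => (K * (w / N : ℝ) ^ a) ^ w) atTop (𝓝 0) := by
      have hroot := (tendsto_const_div_atTop_nhds_zero_nat (w : ℝ)).rpow_const (Or.inr ha.le)
      simpa [ha.ne', hw] using (hroot.const_mul K).pow w
    exact squeeze_zero (fun N => Set.indicator_nonneg (fun _ _ => by positivity) _)
      (fun N => Set.indicator_le_self' (fun _ _ => by positivity) _) hlim
  · rw [Real.norm_of_nonneg (Set.indicator_nonneg (fun _ _ => by positivity) _)]
    refine Set.indicator_le' (fun w hw => ?_) (fun _ _ => by positivity) w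
    obtain ⟨hw1, hwx⟩ := mem_Ico.1 hw
    rw [Nat.lt_ceil] at hwx
    gcongr
    exact div_le_of_le_mul₀ (Nat.cast_nonneg N) hx hwx.le

end Tail

end PDGLDPC

open PDGLDPC in
theorem theorem1_general {nc nv : ℕ} (B : Matrix (Fin nc) (Fin nv) ℕ) (D : Finset (Fin nv))
    {μ : ℕ} (C : Submodule (ZMod 2) (Fin μ → ZMod 2))
    (hundoped : ∀ j ∉ D, 2 ≤ varDegree B j)
    (hdoped : ∀ j ∈ D, 2 < (varDegree B j : ℕ∞) * minDist C)
    (hcycle : NoUndopedDegTwoCycle B D) : HasTypicalMinDist B D C := by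
  obtain ⟨a, ha0, ha⟩ := exists_pos_forall_hammingNorm_blocks_add_le hundoped hdoped hcycle
  let K := Real.exp
    (nc * Fintype.card (Edge B → ZMod 2) + nv * Fintype.card (Fin μ → ZMod 2))
  obtain ⟨x, hx0, hx1, hKx⟩ := exists_mul_rpow_lt_one K ha0
  have htail : Tendsto (fun β : ℕ =>
      ∑ w ∈ Finset.Ico 1 ⌈x * (β * μ : ℕ)⌉₊, (K * (w / (β * μ : ℕ) : ℝ) ^ a) ^ w) atTop (𝓝 0) := by
    obtain rfl | hμ := Nat.eq_zero_or_pos μ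
    · simp
    · exact (tendsto_sum_Ico_mul_rpow_pow (Real.exp_nonneg _) ha0 hx0.le hKx).comp
        (tendsto_id.atTop_mul_const' hμ)
  refine ⟨x / (nv + 1), by positivity, squeeze_zero (fun β => liftingProb_nonneg _) (fun β => ?_)
    htail⟩
  have hδ : x / (nv + 1) * (nv * (β * μ)) ≤ x * (β * μ : ℕ) := by
    rw [div_mul_eq_mul_div, div_le_iff₀ (by positivity)]
    push_cast
    linarith [show 0 ≤ x * (β * μ) by positivity]
  exact (liftingProb_mono fun π hπ => hπ.trans_le (ENNReal.ofReal_le_ofReal hδ)).trans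
    (liftingProb_minDist_lt_le (ha β) hx1)

theorem theorem1 {nc nv : ℕ} (B : Matrix (Fin nc) (Fin nv) ℕ) (D : Finset (Fin nv))
    (μ κ : ℕ) (C : Submodule (ZMod 2) (Fin μ → ZMod 2)) (hC : PDGLDPC.IsHammingCode κ C)
    (hundoped : ∀ j, j ∉ D → 2 ≤ PDGLDPC.varDegree B j)
    (hdoped : ∀ j ∈ D, 1 ≤ PDGLDPC.varDegree B j)
    (hcycle : PDGLDPC.NoUndopedDegTwoCycle B D) :
    PDGLDPC.HasTypicalMinDist B D C := by
  have hdegree : ∀ j ∈ D, (1 : ℕ∞) ≤ PDGLDPC.varDegree B j := fun j hj => mod_cast hdoped j hj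
  exact theorem1_general B D C hundoped (fun j hj => lt_of_lt_of_le (b := 1 * 3) (by norm_num)
    (mul_le_mul' (hdegree j hj) hC.three_le_minDist)) hcycle
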